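/- Let $S=\mathbb{C}[x,y,z]$. For a reduced plane curve $C: f=0$ of degree $d$ in $\mathbb{P}^2=\mathbb{P}^2(\mathbb{C})$, let $D_0(f)=\{(a,b,c)\in S^3 : af_x+bf_y+cf_z=0\}$ be the graded $S$-module of Jacobian syzygies. The exponents $(d_1,\dots,d_m)$ of $C$, with $d_1\le\dots\le d_m$, are the degrees of a minimal system of homogeneous generators of $D_0(f)$, and the type of $C$ is $t(C)=d_1+d_2+1-d$. The curve $C$ is free if $D_0(f)$ is a free $S$-module, and it is plus-one generated with exponents $(d_1,d_2,d_3)$ if $D_0(f)$ has a graded minimal free resolution $0\to S(-d_3-1)\to S(-d_1)\oplus S(-d_2)\oplus S(-d_3)\to D_0(f)\to 0$. **Proposition.** Let $1\le n_1\le n_2$ be integers with $n_1+n_2>2$, and let $a_1,a_2\in\mathbb{P}^2$. Let $\mathcal{B}_1$ be a set of $n_1$ distinct lines passing through $a_1$, none of which passes through $a_2$, and let $\mathcal{B}_2$ be a set of $n_2$ distinct lines passing through $a_2$. If $n_1\ge 2$, assume moreover that no line of $\mathcal{B}_2$ passes through $a_1$. Let $\mathcal{A}'=\mathcal{B}_1\cup\mathcal{B}_2$.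 1. If $n_1=1$, then $\mathcal{A}'$ is free, of type $0$, with exponents $(1,n_1+n_2-2)$. 2. If $n_1\ge 2$, then $\mathcal{A}'$ is plus-one generated, of type $1$, with exponents $(n_1,n_2,n_1+n_2-2)$. -/

import Mathlib

open scoped LinearAlgebra.Projectivization

noncomputable section

namespace PlaneCurve

/-- The graded polynomial ring `S = ℂ[x, y, z]`. -/
abbrev S : Type := MvPolynomial (Fin 3) ℂ

/-- The complex projective plane. -/
abbrev Plane : Type := ℙ ℂ (Fin 3 → ℂ)

/-- A line `u x + v y + w z = 0` of the projective plane, given by the point `(u : v : w)` of the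
dual projective plane, so that distinct elements are distinct lines. -/
abbrev Line : Type := ℙ ℂ (Fin 3 → ℂ)

/-- The point `p` lies on the line `L`, that is, `u p₀ + v p₁ + w p₂ = 0`. -/
def OnLine (p : Plane) (L : Line) : Prop := Projectivization.orthogonal L p

/-- A linear form defining the line `L` (well defined up to a nonzero constant). -/
def lineForm (L : Line) : S := ∑ i, MvPolynomial.C (L.rep i) * MvPolynomial.X i

/-- A defining polynomial of the line arrangement `A`, a finite set of lines: the product of the
linear forms of its lines (well defined up to a nonzero constant). -/
def arrangementPoly (A : Finset Line) : S := ∏ L ∈ A, lineForm L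

/-- The module `D₀(f) = {(a, b, c) ∈ S³ : a f_x + b f_y + c f_z = 0}` of Jacobian syzygies. -/
def jacobianSyzygies (f : S) : Submodule S (Fin 3 → S) where
  carrier := {a | ∑ j, a j * MvPolynomial.pderiv j f = 0}
  add_mem' := by
    intro a b ha hb
    simp only [Set.mem_setOf_eq] at ha hb ⊢
    simp only [Pi.add_apply, add_mul, Finset.sum_add_distrib, ha, hb, add_zero]
  zero_mem' := by simp
  smul_mem' := by
    intro c a ha
    simp only [Set.mem_setOf_eq] at ha ⊢
    simp only [Pi.smul_apply, smul_eq_mul, mul_assoc, ← Finset.mul_sum, ha, mul_zero]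

/-- `r₁, …, r_m` is a minimal system of homogeneous generators of `D₀(f)`, where `r_i` has degree
`d_i` and `d₁ ≤ … ≤ d_m`: the `r_i` generate `D₀(f)` and none of them can be omitted. -/
structure IsMinimalGenerators (f : S) {m : ℕ} (d : Fin m → ℕ) (r : Fin m → Fin 3 → S) : Prop where
  monotone : Monotone d
  homogeneous : ∀ i j, (r i j).IsHomogeneous (d i)
  span_eq : Submodule.span S (Set.range r) = jacobianSyzygies f
  minimal : ∀ i, r i ∉ Submodule.span S (r '' {j | j ≠ i})

/-- The curve `f = 0` has exponents `(d₁, …, d_m)`: these are the degrees, in increasing order, of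
a minimal system of homogeneous generators of `D₀(f)`. -/
def HasExponents (f : S) {m : ℕ} (d : Fin m → ℕ) : Prop :=
  ∃ r : Fin m → Fin 3 → S, IsMinimalGenerators f d r

/-- The curve `f = 0` has type `t`, that is, `t = d₁ + d₂ + 1 - deg f`, where `d₁ ≤ d₂` are the
two smallest exponents. -/
def HasType (f : S) (t : ℤ) : Prop :=
  ∃ (m : ℕ) (d : Fin (m + 2) → ℕ), HasExponents f d ∧
    t = (d 0 : ℤ) + (d 1 : ℤ) + 1 - (f.totalDegree : ℤ)

/-- The curve `f = 0` is free: `D₀(f)` is a free `S`-module. -/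
def IsFreeCurve (f : S) : Prop := Module.Free S (jacobianSyzygies f)

/-- The curve `f = 0` is plus-one generated with exponents `(d₁, d₂, d₃)`: the module `D₀(f)` has
a graded minimal free resolution
`0 → S(-d₃-1) → S(-d₁) ⊕ S(-d₂) ⊕ S(-d₃) → D₀(f) → 0`.
Here `r` gives the second map, and the first map sends `1` to `ρ`; it is injective since `ρ ≠ 0`.
-/
def IsPlusOneGenerated (f : S) (d : Fin 3 → ℕ) : Prop :=
  ∃ r : Fin 3 → Fin 3 → S, IsMinimalGenerators f d r ∧
    ∃ ρ : Fin 3 → S, ρ ≠ 0 ∧ (∀ i, (ρ i).IsHomogeneous (d 2 + 1 - d i)) ∧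
      ∀ c : Fin 3 → S, ∑ i, c i • r i = 0 ↔ ∃ q : S, c = q • ρ

end PlaneCurve

end

/-!
Choose linear coordinates `x, y, z` in which `a₂ = (1 : 0 : 0)` and `a₁ = (0 : 1 : 0)`, so that
`B₁` has an equation `p(x, z)` of degree `n₁` and, if no line of `B₂` passes through `a₁`, `B₂` has
an equation `q(y, z)` of degree `n₂`. Syzygies are read as vector fields killing `f = p q`
(`fromCoords`), so that no automorphism of the polynomial ring is needed: `dirDeriv` and
`coordForm` provide the partial derivatives and the coordinates of an arbitrary basis.

A field killing `p q` maps `p` to `h p` and `q` to `-h q`, as `p` and `q` are coprime. Each of `p`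
and `q` is a reduced form in two variables, so its two partial derivatives are coprime
(`isRelPrime_dirDeriv_pencil`), and a field mapping such a form to a multiple of itself is a
combination of the Euler field and the Hamiltonian field of the form
(`exists_eq_euler_add_hamiltonian`). So the field is given by the coefficients `u`, `v` of the two
Hamiltonian fields and by `h`, and the two values found for its `z`-component must agree, which says
`(n₁ + n₂) z h = n₂ u p_x - n₁ v q_y`. Modulo `z`, `p_x` and `q_y` are nonzero multiples of
`x ^ (n₁ - 1)` and `y ^ (n₂ - 1)`. Hence the pairs `(u, v)` that occur are generated by `(z, 0)`,
`(0, z)` and one pair made of these two powers (`exists_coeffs_of_coordForm_dvd`), which yields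
generators of degrees `n₁`, `n₂`, `n₁ + n₂ - 2`, and `z` times the third is a combination of the
first two. Every relation is a multiple of this one (`isPlusOneGenerated_of_pencils`).

If `n₁ = 1`, the second and third basis vectors are taken on the line of `B₁`, so that
`f = x q(y, z)`, and the lines of `B₂` are arbitrary lines through `a₂`. The same analysis of `q`
alone shows that `n₂ x ∂x - y ∂y - z ∂z` and `q_z ∂y - q_y ∂z` form a basis of `D₀(f)`
(`exists_basis_of_line_union_pencil`).
-/

noncomputable section

namespace PlaneCurve

open MvPolynomial

/-! ### Linear forms -/

/-- The linear form with coefficient vector `u`. -/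
def linForm (u : Fin 3 → ℂ) : S := ∑ i, C (u i) * X i

lemma linForm_isHomogeneous (u : Fin 3 → ℂ) : (linForm u).IsHomogeneous 1 :=
  IsHomogeneous.sum _ _ _ fun i _ => by
    simpa using (isHomogeneous_C (Fin 3) (u i)).mul (isHomogeneous_X ℂ i)

lemma coeff_linForm (u : Fin 3 → ℂ) (i : Fin 3) :
    (linForm u).coeff (Finsupp.single i 1) = u i := by
  classical
  rw [linForm, coeff_sum, Finset.sum_eq_single i]
  · simp
  · intro j _ hj
    rw [coeff_C_mul, coeff_X, if_neg, mul_zero]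
    rwa [Finsupp.single_left_inj one_ne_zero]
  · simp

lemma linForm_injective : Function.Injective linForm := fun u w h =>
  funext fun i => by rw [← coeff_linForm u, h, coeff_linForm]

lemma linForm_smul (c : ℂ) (u : Fin 3 → ℂ) : linForm (c • u) = C c * linForm u := by
  simp [linForm, Finset.mul_sum, mul_assoc]

lemma linForm_ne_zero {u : Fin 3 → ℂ} (hu : u ≠ 0) : linForm u ≠ 0 := fun h =>
  hu (linForm_injective (by rw [h]; simp [linForm]))

lemma linForm_prime {u : Fin 3 → ℂ} (hu : u ≠ 0) : Prime (linForm u) := by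
  obtain ⟨i, hi⟩ := Function.ne_iff.mp hu
  refine (irreducible_of_totalDegree_eq_one
    ((linForm_isHomogeneous u).totalDegree (linForm_ne_zero hu)) fun r hr => ?_).prime
  have h := hr (Finsupp.single i 1)
  rw [coeff_linForm] at h
  exact (ne_zero_of_dvd_ne_zero hi h).isUnit

/-- A linear form divides a nonzero linear form only if the two are proportional. -/
lemma exists_smul_of_linForm_dvd {u w : Fin 3 → ℂ} (hu : u ≠ 0) (hw : w ≠ 0)
    (h : linForm u ∣ linForm w) : ∃ c : ℂ, c • u = w := by
  obtain ⟨t, ht⟩ := (linForm_prime hu).associated_of_dvd (linForm_prime hw) h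
  obtain ⟨c, -, hc⟩ := isUnit_iff_eq_C_of_isReduced.mp t.isUnit
  exact ⟨c, linForm_injective (by rw [linForm_smul, ← ht, hc, mul_comm])⟩

lemma lineForm_eq_linForm (L : Line) : lineForm L = linForm L.rep := rfl

lemma lineForm_prime (L : Line) : Prime (lineForm L) := linForm_prime L.rep_nonzero

lemma lineForm_isHomogeneous (L : Line) : (lineForm L).IsHomogeneous 1 := linForm_isHomogeneous _

lemma eq_of_lineForm_dvd {L M : Line} (h : lineForm L ∣ lineForm M) : L = M := by
  obtain ⟨c, hc⟩ := exists_smul_of_linForm_dvd L.rep_nonzero M.rep_nonzero h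
  rw [← L.mk_rep, ← M.mk_rep]
  exact ((Projectivization.mk_eq_mk_iff' ..).mpr ⟨c, hc⟩).symm

lemma onLine_iff (p : Plane) (L : Line) : OnLine p L ↔ L.rep ⬝ᵥ p.rep = 0 := by
  conv_lhs => rw [← L.mk_rep, ← p.mk_rep]
  exact Projectivization.orthogonal_mk L.rep_nonzero p.rep_nonzero

/-! ### Directional derivatives and linear coordinates -/

/-- The derivative in the direction of the constant vector field `v`. -/
def dirDeriv (v : Fin 3 → ℂ) : Derivation ℂ S S := mkDerivation ℂ fun j => C (v j)

lemma dirDeriv_apply (v : Fin 3 → ℂ) (f : S) : dirDeriv v f = ∑ j, C (v j) * pderiv j f := by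
  have : dirDeriv v =
      (C (v 0) : S) • pderiv 0 + (C (v 1) : S) • pderiv 1 + (C (v 2) : S) • pderiv 2 := by
    refine derivation_ext fun i => ?_
    fin_cases i <;> simp [dirDeriv, pderiv_X]
  simp [this, Fin.sum_univ_three]

lemma dirDeriv_linForm (v u : Fin 3 → ℂ) : dirDeriv v (linForm u) = C (u ⬝ᵥ v) := by
  simp [linForm, dirDeriv, Derivation.leibniz, dotProduct]

lemma dirDeriv_isHomogeneous (v : Fin 3 → ℂ) {f : S} {n : ℕ} (hf : f.IsHomogeneous n) :
    (dirDeriv v f).IsHomogeneous (n - 1) := by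
  rw [dirDeriv_apply]
  exact IsHomogeneous.sum _ _ _ fun j _ => hf.pderiv.C_mul _

/-- The linear forms dual to a basis `b` of `ℂ³`: the coordinates of `ℂ³` with respect to `b`. -/
def coordForm (b : Module.Basis (Fin 3) ℂ (Fin 3 → ℂ)) (i : Fin 3) : S :=
  linForm fun k => b.coord i (Pi.single k 1)

variable (b : Module.Basis (Fin 3) ℂ (Fin 3 → ℂ))

lemma coord_eq_sum (i : Fin 3) (v : Fin 3 → ℂ) :
    b.coord i v = ∑ k, b.coord i (Pi.single k 1) * v k := by
  conv_lhs => rw [pi_eq_sum_univ' v]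
  simp only [map_sum, map_smul, smul_eq_mul]
  exact Finset.sum_congr rfl fun k _ => mul_comm _ _

lemma sum_coord_mul (j k : Fin 3) :
    ∑ i, b.coord i (Pi.single k 1) * b i j = if k = j then 1 else 0 := by
  have := congrFun (b.sum_repr (Pi.single k 1)) j
  simpa [Pi.single_apply, eq_comm] using this

lemma dirDeriv_coordForm (i j : Fin 3) :
    dirDeriv (b i) (coordForm b j) = if i = j then 1 else 0 := by
  rw [coordForm, dirDeriv_linForm, dotProduct, ← coord_eq_sum, Module.Basis.coord_apply,
    Module.Basis.repr_self, Finsupp.single_apply]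
  split_ifs <;> simp

lemma linForm_eq_sum_coordForm (u : Fin 3 → ℂ) :
    linForm u = ∑ i, C (u ⬝ᵥ b i) * coordForm b i := by
  have h : ∀ k, C (u k) = ∑ i, C (u ⬝ᵥ b i) * C (b.coord i (Pi.single k 1)) (σ := Fin 3) := by
    intro k
    simp only [← C_mul, ← map_sum]
    congr 1
    simp only [dotProduct, Finset.sum_mul]
    rw [Finset.sum_comm]
    simp only [mul_assoc, ← Finset.mul_sum]
    have := fun j => sum_coord_mul b j k
    simp only [mul_comm (b _ _), this]
    simp
  simp only [linForm, coordForm, Finset.mul_sum]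
  rw [Finset.sum_comm]
  refine Finset.sum_congr rfl fun k _ => ?_
  rw [h, Finset.sum_mul]
  simp only [mul_assoc]

lemma coordForm_isHomogeneous (i : Fin 3) : (coordForm b i).IsHomogeneous 1 :=
  linForm_isHomogeneous _

lemma coordForm_prime (i : Fin 3) : Prime (coordForm b i) := by
  refine linForm_prime fun h => ?_
  have := dirDeriv_coordForm b i i
  rw [coordForm, h, dirDeriv_linForm] at this
  simp at this

lemma not_coordForm_dvd {i j : Fin 3} (hij : i ≠ j) : ¬ coordForm b i ∣ coordForm b j := by
  intro h
  obtain ⟨t, ht⟩ := (coordForm_prime b i).associated_of_dvd (coordForm_prime b j) h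
  obtain ⟨c, hc, hc'⟩ := isUnit_iff_eq_C_of_isReduced.mp t.isUnit
  have := congrArg (dirDeriv (b i)) ht
  rw [hc', mul_comm, Derivation.leibniz, dirDeriv_coordForm, dirDeriv_coordForm] at this
  simp [hij] at this
  simp [this] at hc

/-- Substituting `0` for the coordinate `coordForm b 2` and fixing the two others. -/
def killLast : S →ₐ[ℂ] S := aeval fun j => X j - C (b 2 j) * coordForm b 2

lemma killLast_linForm (u : Fin 3 → ℂ) :
    killLast b (linForm u) = linForm u - C (u ⬝ᵥ b 2) * coordForm b 2 := by
  simp [killLast, linForm, dotProduct, mul_sub, Finset.sum_sub_distrib, Finset.sum_mul, mul_assoc,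
    algebraMap_eq]

lemma killLast_coordForm (i : Fin 3) :
    killLast b (coordForm b i) = if i = 2 then 0 else coordForm b i := by
  have h := dirDeriv_coordForm b 2 i
  rw [coordForm, dirDeriv_linForm] at h
  rw [coordForm, killLast_linForm, h]
  split_ifs with h1 h2 h2
  · rw [h2, coordForm]; simp
  · exact absurd h1.symm h2
  · exact absurd h2.symm h1
  · simp

lemma coordForm_dvd_sub_killLast (f : S) : coordForm b 2 ∣ f - killLast b f := by
  induction f using MvPolynomial.induction_on with
  | C a => simp [killLast, algebraMap_eq]
  | add p q hp hq => rw [map_add, add_sub_add_comm]; exact dvd_add hp hq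
  | mul_X p i hp =>
    have h : killLast b (X i) = X i - C (b 2 i) * coordForm b 2 := by simp [killLast]
    rw [map_mul, h]
    obtain ⟨t, ht⟩ := hp
    exact ⟨t * X i + killLast b p * C (b 2 i), by linear_combination X i * ht⟩

/-! ### Line arrangements -/

lemma arrangementPoly_ne_zero (B : Finset Line) : arrangementPoly B ≠ 0 :=
  Finset.prod_ne_zero_iff.mpr fun L _ => (lineForm_prime L).ne_zero

lemma arrangementPoly_isHomogeneous (B : Finset Line) :
    (arrangementPoly B).IsHomogeneous B.card := by
  simpa [arrangementPoly] using
    IsHomogeneous.prod B lineForm (fun _ => 1) fun L _ => lineForm_isHomogeneous L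

lemma exists_dvd_of_prime_dvd_arrangementPoly {B : Finset Line} {π : S} (hπ : Prime π)
    (h : π ∣ arrangementPoly B) : ∃ L ∈ B, Associated π (lineForm L) := by
  obtain ⟨L, hL, hd⟩ := (hπ.dvd_finsetProd_iff _).mp h
  exact ⟨L, hL, hπ.associated_of_dvd (lineForm_prime L) hd⟩

lemma isRelPrime_arrangementPoly {B B' : Finset Line} (h : Disjoint B B') :
    IsRelPrime (arrangementPoly B) (arrangementPoly B') := by
  refine IsRelPrime.prod_left fun L hL => IsRelPrime.prod_right fun M hM => ?_
  refine (lineForm_prime L).irreducible.isRelPrime_iff_not_dvd.mpr fun hd => ?_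
  exact Finset.disjoint_left.mp h hL (eq_of_lineForm_dvd hd ▸ hM)

/-- A derivation having every linear form of an arrangement as an eigenvector with eigenvalue `c`
has the defining polynomial as an eigenvector. -/
lemma derivation_arrangementPoly (D : Derivation ℂ S S) (c : S) {B : Finset Line}
    (h : ∀ L ∈ B, D (lineForm L) = c * lineForm L) :
    D (arrangementPoly B) = B.card * c * arrangementPoly B := by
  classical
  induction B using Finset.induction_on with
  | empty => simp [arrangementPoly]
  | insert L B hL ih =>
    have h1 := ih fun M hM => h M (Finset.mem_insert_of_mem hM)
    have h2 := h L (Finset.mem_insert_self L B)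
    unfold arrangementPoly at h1 ⊢
    rw [Finset.prod_insert hL, Derivation.leibniz, h1, h2, Finset.card_insert_of_notMem hL]
    simp only [smul_eq_mul]
    push_cast
    ring

/-- The defining polynomial of an arrangement is reduced: `lineForm L` divides its derivative only
in the directions of `L`. -/
lemma dotProduct_eq_zero_of_lineForm_dvd {B : Finset Line} {L : Line} (hL : L ∈ B)
    {v : Fin 3 → ℂ} (h : lineForm L ∣ dirDeriv v (arrangementPoly B)) : L.rep ⬝ᵥ v = 0 := by
  classical
  rw [arrangementPoly, ← Finset.mul_prod_erase B _ hL, Derivation.leibniz, smul_eq_mul,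
    smul_eq_mul, dvd_add_right (dvd_mul_right _ _), lineForm_eq_linForm, dirDeriv_linForm] at h
  rcases (lineForm_prime L).dvd_or_dvd h with h | h
  · obtain ⟨M, hM, hd⟩ := ((lineForm_prime L).dvd_finsetProd_iff _).mp h
    exact absurd (eq_of_lineForm_dvd hd).symm (Finset.ne_of_mem_erase hM)
  · by_contra h0
    exact (lineForm_prime L).not_isUnit (isUnit_of_dvd_unit h ((isUnit_iff_ne_zero.mpr h0).map C))

/-! ### Pencils of lines

The forms of all lines of `B` are combinations of two of the three coordinates, that is, the lines
pass through a common point. -/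

section Pencil

variable {b : Module.Basis (Fin 3) ℂ (Fin 3 → ℂ)} {i k : Fin 3} {B : Finset Line}

/-- Euler's identity in the two coordinates on which the form of a pencil depends. -/
lemma euler_pencil (hik : i ≠ k) (h : ∀ L ∈ B, lineForm L =
      C (L.rep ⬝ᵥ b i) * coordForm b i + C (L.rep ⬝ᵥ b k) * coordForm b k) :
    coordForm b i * dirDeriv (b i) (arrangementPoly B) +
      coordForm b k * dirDeriv (b k) (arrangementPoly B) = B.card * arrangementPoly B := by
  have := derivation_arrangementPoly
    (coordForm b i • dirDeriv (b i) + coordForm b k • dirDeriv (b k)) 1 (B := B) fun L hL => by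
      rw [h L hL]
      simp [Derivation.leibniz, dirDeriv_coordForm, hik, hik.symm, ← algebraMap_eq]
      ring
  simpa using this

/-- Since a pencil is reduced, the two partial derivatives of its form are coprime: by Euler's
identity a common prime factor is one of the lines, and `dotProduct_eq_zero_of_lineForm_dvd` then
makes both coefficients of this line vanish. -/
lemma isRelPrime_dirDeriv_pencil (hik : i ≠ k) (hB : B.Nonempty) (h : ∀ L ∈ B, lineForm L =
      C (L.rep ⬝ᵥ b i) * coordForm b i + C (L.rep ⬝ᵥ b k) * coordForm b k) :
    IsRelPrime (dirDeriv (b i) (arrangementPoly B)) (dirDeriv (b k) (arrangementPoly B)) := by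
  have hE := euler_pencil hik h
  have hc : (B.card : S) ≠ 0 := Nat.cast_ne_zero.mpr hB.card_pos.ne'
  have hu : IsUnit (B.card : S) := by
    rw [← map_natCast C]
    exact (isUnit_iff_ne_zero.mpr (Nat.cast_ne_zero.mpr hB.card_pos.ne')).map C
  refine WfDvdMonoid.isRelPrime_of_no_irreducible_factors ?_ fun π hπ h1 h2 => ?_
  · rintro ⟨h1, h2⟩
    rw [h1, h2, mul_zero, mul_zero, add_zero] at hE
    exact mul_ne_zero hc (arrangementPoly_ne_zero B) hE.symm
  · have hd : π ∣ B.card * arrangementPoly B := by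
      rw [← hE]; exact dvd_add (h1.mul_left _) (h2.mul_left _)
    obtain ⟨L, hL, hA⟩ := exists_dvd_of_prime_dvd_arrangementPoly hπ.prime (hu.dvd_mul_left.mp hd)
    have e1 := dotProduct_eq_zero_of_lineForm_dvd hL (hA.symm.dvd.trans h1)
    have e2 := dotProduct_eq_zero_of_lineForm_dvd hL (hA.symm.dvd.trans h2)
    apply (lineForm_prime L).ne_zero
    rw [h L hL, e1, e2]
    simp

/-- Modulo one of the two coordinates, the defining polynomial of a pencil is a multiple of a
power of the other. -/
lemma exists_pencil_eq_pow_add (hB : B.Nonempty) (h : ∀ L ∈ B, lineForm L =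
      C (L.rep ⬝ᵥ b i) * coordForm b i + C (L.rep ⬝ᵥ b k) * coordForm b k) :
    ∃ R : S, R.IsHomogeneous (B.card - 1) ∧ arrangementPoly B =
      C (∏ L ∈ B, L.rep ⬝ᵥ b i) * coordForm b i ^ B.card + coordForm b k * R := by
  classical
  induction hB using Finset.Nonempty.cons_induction with
  | singleton L =>
    refine ⟨C (L.rep ⬝ᵥ b k), isHomogeneous_C _ _, ?_⟩
    simp [arrangementPoly, h L (by simp), mul_comm]
  | cons L B hL hB ih =>
    obtain ⟨R, hR, e⟩ := ih fun M hM => h M (by simp [hM])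
    refine ⟨C (L.rep ⬝ᵥ b k) * C (∏ L ∈ B, L.rep ⬝ᵥ b i) * coordForm b i ^ B.card +
      lineForm L * R, ?_, ?_⟩
    · rw [Finset.card_cons, Nat.add_sub_cancel]
      refine IsHomogeneous.add ?_ ?_
      · rw [← C_mul]
        simpa using ((coordForm_isHomogeneous b i).pow B.card).C_mul
          ((L.rep ⬝ᵥ b k) * ∏ L ∈ B, L.rep ⬝ᵥ b i)
      · convert! (lineForm_isHomogeneous L).mul hR using 1
        have := hB.card_pos
        omega
    · have hL' := h L (by simp)
      unfold arrangementPoly at e ⊢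
      rw [Finset.prod_cons, e, Finset.card_cons, Finset.prod_cons, C_mul]
      linear_combination (C (∏ L ∈ B, L.rep ⬝ᵥ b i) * coordForm b i ^ B.card) * hL'

/-- The derivative of a decomposition as in `exists_pencil_eq_pow_add`. -/
lemma dirDeriv_of_pencil_eq_pow_add (hik : i ≠ k) {f R : S} {c : ℂ} {n : ℕ}
    (e : f = C c * coordForm b i ^ n + coordForm b k * R) :
    dirDeriv (b i) f =
      (n : S) * (C c * coordForm b i ^ (n - 1)) + coordForm b k * dirDeriv (b i) R := by
  have hC : dirDeriv (b i) (C c) = 0 := (dirDeriv (b i)).map_algebraMap c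
  rw [e]
  simp only [map_add, Derivation.leibniz, Derivation.leibniz_pow, dirDeriv_coordForm, hC,
    if_neg hik, smul_eq_mul, nsmul_eq_mul, if_true]
  ring

end Pencil

/-! ### Syzygies between the partial derivatives of forms in two variables -/

section Algebra

variable {R : Type*} [CommRing R] [IsDomain R] [UniqueFactorizationMonoid R]

/-- The syzygies of two coprime elements are the multiples of the Koszul syzygy. -/
lemma exists_eq_mul_of_isRelPrime {a b A B : R} (h : IsRelPrime a b) (e : A * a + B * b = 0) :
    ∃ v, A = v * b ∧ B = -(v * a) := by
  by_cases hb : b = 0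
  · subst hb
    have ha : IsUnit a := isRelPrime_zero_right.mp h
    obtain ⟨w, hw⟩ := ha.dvd (a := B)
    refine ⟨-w, ?_, ?_⟩
    · simpa [ha.ne_zero] using e
    · rw [hw]; ring
  · have hd : b ∣ A * a := ⟨-B, by linear_combination e⟩
    obtain ⟨v, hv⟩ := h.symm.dvd_of_dvd_mul_right hd
    refine ⟨v, by rw [hv, mul_comm], mul_left_cancel₀ hb ?_⟩
    rw [hv] at e
    linear_combination e

/-- If a derivation with components `A` and `B` maps `q`, homogeneous of degree `n` in two
variables `y` and `z`, to `h * q`, then it is a multiple of the Euler derivation plus a multiple of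
the Hamiltonian derivation of `q`. -/
lemma exists_eq_euler_add_hamiltonian {y z qy qz q n A B h : R} (hq : IsRelPrime qy qz)
    (euler : y * qy + z * qz = n * q) (e : A * qy + B * qz = h * q) :
    ∃ v, n * A = h * y + v * qz ∧ n * B = h * z - v * qy := by
  obtain ⟨v, h1, h2⟩ := exists_eq_mul_of_isRelPrime (A := n * A - h * y) (B := n * B - h * z) hq
    (by linear_combination n * e - h * euler)
  exact ⟨v, by linear_combination h1, by linear_combination h2⟩

/-- A derivation killing `p * q`, where `p` is a form in `x, z` of degree `n₁` and `q` is a form in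
`y, z` of degree `n₂`, is a combination of the two obvious ones after multiplication by
`(n₁ + n₂) * z`. -/
lemma exists_coeffs_of_syzygy {x y z px pz qy qz p q n₁ n₂ A₀ A₁ A₂ : R}
    (hn₁ : n₁ ≠ 0) (hn₂ : n₂ ≠ 0) (hp₀ : p ≠ 0) (hpq : IsRelPrime p q)
    (hp : IsRelPrime px pz) (hq : IsRelPrime qy qz)
    (hp' : x * px + z * pz = n₁ * p) (hq' : y * qy + z * qz = n₂ * q)
    (e : A₀ * (px * q) + A₁ * (p * qy) + A₂ * (pz * q + p * qz) = 0) :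
    ∃ u v, z ∣ n₂ * u * px - n₁ * v * qy ∧
      (n₁ + n₂) * z * A₀ = u * ((n₁ + n₂) * p - x * px) - v * (x * qy) ∧
      (n₁ + n₂) * z * A₁ = v * ((n₁ + n₂) * q - y * qy) - u * (y * px) ∧
      (n₁ + n₂) * z * A₂ = -(u * (z * px)) - v * (z * qy) := by
  -- The derivation is logarithmic along `p` and along `q`, with opposite cofactors `h` and `-h`.
  have hd : p ∣ (A₀ * px + A₂ * pz) * q := ⟨-(A₁ * qy + A₂ * qz), by linear_combination e⟩
  obtain ⟨h, hh⟩ := hpq.dvd_of_dvd_mul_right hd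
  have hh' : A₁ * qy + A₂ * qz = -h * q := mul_left_cancel₀ hp₀ (by linear_combination e - q * hh)
  obtain ⟨u, u1, u2⟩ := exists_eq_euler_add_hamiltonian hp hp' (hh.trans (mul_comm _ _))
  obtain ⟨v, v1, v2⟩ := exists_eq_euler_add_hamiltonian hq hq' hh'
  -- Comparing the two expressions of `A₂` gives `(n₁ + n₂) * h * z = n₂ * u * px - n₁ * v * qy`.
  refine ⟨u, v, ⟨(n₁ + n₂) * h, by linear_combination n₂ * u2 - n₁ * v2⟩,
    mul_left_cancel₀ hn₁ ?_, mul_left_cancel₀ hn₂ ?_, ?_⟩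
  · linear_combination (n₁ + n₂) * z * u1 + (n₁ + n₂) * u * hp'
      + x * (n₁ * v2 - n₂ * u2)
  · linear_combination (n₁ + n₂) * z * v1 + (n₁ + n₂) * v * hq'
      + y * (-n₁ * v2 + n₂ * u2)
  · linear_combination z * (u2 + v2)

end Algebra

/-- The syzygies of (multiples of) powers of two coordinates modulo the third coordinate: setting
the third coordinate to `0` reduces to coprime elements of `S`. -/
lemma exists_coeffs_of_coordForm_dvd (b : Module.Basis (Fin 3) ℂ (Fin 3 → ℂ)) {α β : ℂ}
    (hα : α ≠ 0) (hβ : β ≠ 0) {m k : ℕ} {u v : S}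
    (h : coordForm b 2 ∣
      u * (C α * coordForm b 0 ^ m) - v * (C β * coordForm b 1 ^ k)) :
    ∃ w s t : S, u = w * (C β * coordForm b 1 ^ k) + coordForm b 2 * s ∧
      v = w * (C α * coordForm b 0 ^ m) + coordForm b 2 * t := by
  obtain ⟨s, hs⟩ := coordForm_dvd_sub_killLast b u
  obtain ⟨t, ht⟩ := coordForm_dvd_sub_killLast b v
  have hrel : IsRelPrime (C α * coordForm b 0 ^ m) (C β * coordForm b 1 ^ k) := by
    have h1 : IsUnit (C α : S) := (isUnit_iff_ne_zero.mpr hα).map C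
    have h2 : IsUnit (C β : S) := (isUnit_iff_ne_zero.mpr hβ).map C
    rw [isRelPrime_mul_unit_left_left h1, isRelPrime_mul_unit_left_right h2]
    exact ((coordForm_prime b 0).irreducible.isRelPrime_iff_not_dvd.mpr
      (not_coordForm_dvd b (by decide))).pow
  have h0 : killLast b (u * (C α * coordForm b 0 ^ m) - v * (C β * coordForm b 1 ^ k)) = 0 := by
    obtain ⟨g, hg⟩ := h
    rw [hg, map_mul, killLast_coordForm]
    simp
  have hC : ∀ a : ℂ, killLast b (C a) = C a := fun a => by simp [killLast, algebraMap_eq]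
  simp only [map_sub, map_mul, map_pow, killLast_coordForm, hC] at h0
  obtain ⟨w, h1, h2⟩ := exists_eq_mul_of_isRelPrime hrel
    (A := killLast b u) (B := - killLast b v) (by simpa [sub_eq_add_neg] using h0)
  exact ⟨w, s, t, by linear_combination hs + h1, by linear_combination ht - h2⟩

/-! ### Jacobian syzygies in linear coordinates -/

/-- The vector field on `ℂ³`, in standard components, whose components with respect to the basis
`b` are `A`. -/
def fromCoords (b : Module.Basis (Fin 3) ℂ (Fin 3 → ℂ)) : (Fin 3 → S) →ₗ[S] (Fin 3 → S) where
  toFun A k := ∑ i, A i * C (b i k)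
  map_add' A A' := by ext1 k; simp [add_mul, Finset.sum_add_distrib]
  map_smul' c A := by ext1 k; simp [Finset.mul_sum, mul_assoc]

variable (b : Module.Basis (Fin 3) ℂ (Fin 3 → ℂ))

lemma fromCoords_apply (A : Fin 3 → S) (k : Fin 3) :
    fromCoords b A k = ∑ i, A i * C (b i k) := rfl

lemma fromCoords_surjective : Function.Surjective (fromCoords b) := by
  intro a
  refine ⟨fun i => ∑ k, a k * C (b.coord i (Pi.single k 1)), funext fun j => ?_⟩
  simp only [fromCoords_apply, Finset.sum_mul, mul_assoc, ← C_mul]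
  rw [Finset.sum_comm]
  simp only [← Finset.mul_sum, ← map_sum, sum_coord_mul]
  simp

lemma fromCoords_injective : Function.Injective (fromCoords b) :=
  OrzechProperty.injective_of_surjective_endomorphism _ (fromCoords_surjective b)

lemma fromCoords_mem_jacobianSyzygies {f : S} {A : Fin 3 → S} :
    fromCoords b A ∈ jacobianSyzygies f ↔ ∑ i, A i * dirDeriv (b i) f = 0 := by
  change ∑ k, fromCoords b A k * pderiv k f = 0 ↔ _
  simp only [fromCoords_apply, dirDeriv_apply, Finset.mul_sum, Finset.sum_mul, mul_assoc]
  rw [Finset.sum_comm]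

/-- Generators of the syzygies in the coordinates of `b` give generators of `D₀(f)`; they are
minimal as soon as no relation between them has a coefficient with a constant term. -/
lemma isMinimalGenerators_fromCoords {f : S} {m : ℕ} {d : Fin m → ℕ} {G : Fin m → Fin 3 → S}
    (hd : Monotone d) (hG : ∀ i j, (G i j).IsHomogeneous (d i))
    (hmem : ∀ i, ∑ l, G i l * dirDeriv (b l) f = 0)
    (hgen : ∀ A : Fin 3 → S, ∑ l, A l * dirDeriv (b l) f = 0 → ∃ c : Fin m → S,
      A = ∑ i, c i • G i)
    (hrel : ∀ c : Fin m → S, ∑ i, c i • G i = 0 → ∀ i, constantCoeff (c i) = 0) :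
    IsMinimalGenerators f d fun i => fromCoords b (G i) where
  monotone := hd
  homogeneous i j := IsHomogeneous.sum _ _ _ fun l _ => by
    simpa using (hG i l).mul (isHomogeneous_C (Fin 3) (b l j))
  span_eq := by
    refine le_antisymm (Submodule.span_le.mpr ?_) fun a ha => ?_
    · rintro _ ⟨i, rfl⟩
      exact (fromCoords_mem_jacobianSyzygies b).mpr (hmem i)
    · obtain ⟨A, rfl⟩ := fromCoords_surjective b a
      obtain ⟨c, rfl⟩ := hgen A ((fromCoords_mem_jacobianSyzygies b).mp ha)
      rw [map_sum]
      refine Submodule.sum_mem _ fun i _ => ?_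
      rw [map_smul]
      exact Submodule.smul_mem _ _ (Submodule.subset_span ⟨i, rfl⟩)
  minimal i hi := by
    obtain ⟨l, hl, hli⟩ := (Finsupp.mem_span_image_iff_linearCombination S).mp hi
    have hl0 : l i = 0 := by
      by_contra h0
      exact hl (Finsupp.mem_support_iff.mpr h0) rfl
    have h : ∑ j, (l j - if j = i then 1 else 0) • G j = 0 := by
      apply fromCoords_injective b
      rw [Finsupp.linearCombination_apply, Finsupp.sum_fintype _ _ (by simp)] at hli
      simp [sub_smul, Finset.sum_sub_distrib, map_sum, hli]
    simpa [hl0] using hrel _ h i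

lemma sum_smul_fromCoords_eq_zero_iff {m : ℕ} (G : Fin m → Fin 3 → S) (c : Fin m → S) :
    ∑ i, c i • fromCoords b (G i) = 0 ↔ ∑ i, c i • G i = 0 := by
  simp only [← map_smul, ← map_sum]
  exact map_eq_zero_iff _ (fromCoords_injective b)

/-- Two vectors, one of them in the kernel of the linear form `u` and the other not, extend to a
basis by a vector in the kernel of `u`. -/
lemma exists_basis {u v₀ v₁ : Fin 3 → ℂ} (h₀ : u ⬝ᵥ v₀ ≠ 0) (h₁ : u ⬝ᵥ v₁ = 0) (hv₁ : v₁ ≠ 0) :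
    ∃ b : Module.Basis (Fin 3) ℂ (Fin 3 → ℂ), b 0 = v₀ ∧ b 1 = v₁ ∧ u ⬝ᵥ b 2 = 0 := by
  have hli : LinearIndependent ℂ ![v₀, v₁] := by
    refine LinearIndependent.pair_iff.mpr fun s t e => ?_
    have hs : s = 0 := by simpa [h₀, h₁] using congrArg (u ⬝ᵥ ·) e
    exact ⟨hs, by simpa [hs, hv₁] using e⟩
  obtain ⟨x, hx⟩ := exists_linearIndependent_snoc_of_lt_finrank hli (by simp)
  have hx' := (linearIndependent_finSnoc.mp hx).2
  set y := x - (u ⬝ᵥ x / u ⬝ᵥ v₀) • v₀ with hy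
  have hli3 : LinearIndependent ℂ (Fin.snoc ![v₀, v₁] y : Fin 3 → Fin 3 → ℂ) := by
    refine linearIndependent_finSnoc.mpr ⟨hli, fun hm => hx' ?_⟩
    have h0 : v₀ ∈ Submodule.span ℂ (Set.range ![v₀, v₁]) := Submodule.subset_span ⟨0, rfl⟩
    have : x = y + (u ⬝ᵥ x / u ⬝ᵥ v₀) • v₀ := by rw [hy]; simp
    rw [this]
    exact Submodule.add_mem _ hm (Submodule.smul_mem _ _ h0)
  refine ⟨basisOfLinearIndependentOfCardEqFinrank hli3 (by simp), ?_, ?_, ?_⟩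
  · rw [coe_basisOfLinearIndependentOfCardEqFinrank]; rfl
  · rw [coe_basisOfLinearIndependentOfCardEqFinrank]; rfl
  · rw [coe_basisOfLinearIndependentOfCardEqFinrank]
    change u ⬝ᵥ y = 0
    rw [hy, dotProduct_sub, dotProduct_smul, smul_eq_mul, div_mul_cancel₀ _ h₀, sub_self]

lemma isUnit_natCast {n : ℕ} (hn : n ≠ 0) : IsUnit (n : S) := by
  rw [← map_natCast C]
  exact (isUnit_iff_ne_zero.mpr (Nat.cast_ne_zero.mpr hn)).map C

lemma constantCoeff_eq_zero_of_isHomogeneous {f : S} {n : ℕ} (hf : f.IsHomogeneous n)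
    (hn : n ≠ 0) : constantCoeff f = 0 := by
  rw [constantCoeff_eq]
  exact hf.coeff_eq_zero (by simpa using hn.symm)

lemma totalDegree_arrangementPoly (B : Finset Line) :
    (arrangementPoly B).totalDegree = B.card :=
  (arrangementPoly_isHomogeneous B).totalDegree (arrangementPoly_ne_zero B)

open scoped Classical in
lemma arrangementPoly_union {B₁ B₂ : Finset Line} (h : Disjoint B₁ B₂) :
    arrangementPoly (B₁ ∪ B₂) = arrangementPoly B₁ * arrangementPoly B₂ :=
  Finset.prod_union h

/-! ### One line and a pencil -/

open scoped Classical in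
/-- The syzygies of a line together with a pencil whose centre is not on the line: a linear
field having the forms of the line and of the pencil as eigenvectors, with eigenvalues cancelling on
their product, and the Hamiltonian field of the pencil form a basis. -/
lemma exists_basis_of_line_union_pencil {b : Module.Basis (Fin 3) ℂ (Fin 3 → ℂ)} {L : Line}
    {B : Finset Line} (h0 : L.rep ⬝ᵥ b 0 ≠ 0) (h1 : L.rep ⬝ᵥ b 1 = 0) (h2 : L.rep ⬝ᵥ b 2 = 0)
    (hB : ∀ M ∈ B, M.rep ⬝ᵥ b 0 = 0) (hc : 2 ≤ B.card) :
    ∃ r, IsMinimalGenerators (arrangementPoly ({L} ∪ B)) ![1, B.card - 1] r ∧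
      LinearIndependent S r := by
  have hBne : B.Nonempty := Finset.card_pos.mp (by omega)
  have hdisj : Disjoint {L} B := Finset.disjoint_singleton_left.mpr fun h => h0 (hB L h)
  have hform : ∀ M ∈ B, lineForm M =
      C (M.rep ⬝ᵥ b 1) * coordForm b 1 + C (M.rep ⬝ᵥ b 2) * coordForm b 2 := fun M hM => by
    rw [lineForm_eq_linForm, linForm_eq_sum_coordForm b, Fin.sum_univ_three, hB M hM]
    simp
  have hE := euler_pencil (by decide) hform
  have hrel := isRelPrime_dirDeriv_pencil (by decide) hBne hform
  have hq0 : dirDeriv (b 0) (arrangementPoly B) = 0 := by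
    simpa using derivation_arrangementPoly (dirDeriv (b 0)) 0 (B := B) fun M hM => by
      rw [lineForm_eq_linForm, dirDeriv_linForm, hB M hM]; simp
  have hqh := arrangementPoly_isHomogeneous B
  have hf : arrangementPoly ({L} ∪ B) =
      C (L.rep ⬝ᵥ b 0) * (coordForm b 0 * arrangementPoly B) := by
    rw [arrangementPoly_union hdisj, arrangementPoly, Finset.prod_singleton, lineForm_eq_linForm,
      linForm_eq_sum_coordForm b, Fin.sum_univ_three, h1, h2]
    simp [mul_assoc]
  have hndvd : ¬ coordForm b 0 ∣ arrangementPoly B := by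
    intro h
    have hL : lineForm L = C (L.rep ⬝ᵥ b 0) * coordForm b 0 := by
      rw [lineForm_eq_linForm, linForm_eq_sum_coordForm b, Fin.sum_univ_three, h1, h2]
      simp
    have hL' : lineForm L ∣ arrangementPoly B := by
      rwa [hL, ((isUnit_iff_ne_zero.mpr h0).map C).mul_left_dvd]
    obtain ⟨M, hM, hd⟩ := ((lineForm_prime L).dvd_finsetProd_iff _).mp hL'
    exact h0 (hB L (eq_of_lineForm_dvd hd ▸ hM))
  have hn : (B.card : S) ≠ 0 := Nat.cast_ne_zero.mpr (by omega)
  have hα : (C (L.rep ⬝ᵥ b 0) : S) ≠ 0 := by simpa using h0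
  have hC : ∀ i c, dirDeriv (b i) (C c) = 0 := fun i c => (dirDeriv (b i)).map_algebraMap c
  have hD : ∀ A : Fin 3 → S, ∑ l, A l * dirDeriv (b l) (arrangementPoly ({L} ∪ B)) =
      C (L.rep ⬝ᵥ b 0) * (A 0 * arrangementPoly B + coordForm b 0 *
        (A 1 * dirDeriv (b 1) (arrangementPoly B) +
          A 2 * dirDeriv (b 2) (arrangementPoly B))) := by
    intro A
    rw [hf, Fin.sum_univ_three]
    simp only [Derivation.leibniz, hC, hq0, dirDeriv_coordForm, smul_eq_mul]
    simp
    ring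
  have hx := coordForm_isHomogeneous b
  have hx0 := (coordForm_prime b 0).ne_zero
  generalize arrangementPoly ({L} ∪ B) = f at hD hf ⊢
  have hqy := dirDeriv_isHomogeneous (b 1) hqh
  have hqz := dirDeriv_isHomogeneous (b 2) hqh
  have hq_ne := arrangementPoly_ne_zero B
  generalize arrangementPoly B = q at *
  generalize dirDeriv (b 1) q = qy at *
  generalize dirDeriv (b 2) q = qz at *
  have key : ∀ c : Fin 2 → S, ∑ i, c i • (![![B.card * coordForm b 0, -coordForm b 1,
      -coordForm b 2], ![0, qz, -qy]] : Fin 2 → Fin 3 → S) i = 0 → c = 0 := by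
    intro c hc0
    have e0 := congrFun hc0 0
    have e1 := congrFun hc0 1
    have e2 := congrFun hc0 2
    simp [Fin.sum_univ_two, hn, hx0] at e0 e1 e2
    simp [e0] at e1 e2
    have : c 1 = 0 := by
      by_contra h
      simp [h] at e1 e2
      exact mul_ne_zero hn hq_ne (by rw [← hE, e1, e2]; ring)
    ext i : 1
    fin_cases i
    · exact e0
    · exact this
  refine ⟨_, isMinimalGenerators_fromCoords b (G := ![![B.card * coordForm b 0, -coordForm b 1,
      -coordForm b 2], ![0, qz, -qy]]) ?_ ?_ ?_ ?_ ?_, ?_⟩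
  · intro i j hij
    fin_cases i <;> fin_cases j <;> simp at hij ⊢
    omega
  · intro i j
    have h0' : (B.card * coordForm b 0 : S).IsHomogeneous 1 := by
      rw [← map_natCast C]; exact (hx 0).C_mul _
    fin_cases i <;> fin_cases j
    exacts [h0', (hx 1).neg, (hx 2).neg, isHomogeneous_zero _ _ _, hqz, hqy.neg]
  · intro i
    rw [hD]
    fin_cases i
    · simp; right; linear_combination -coordForm b 0 * hE
    · simp; right; right; ring
  -- The cofactor `h` of the pencil is determined by the component of `A` transverse to the line.
  · intro A hA
    rw [hD, mul_eq_zero, or_iff_right hα] at hA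
    obtain ⟨h, hh⟩ := ((coordForm_prime b 0).dvd_or_dvd
      (show coordForm b 0 ∣ A 0 * q from ⟨-(A 1 * qy + A 2 * qz), by
        linear_combination hA⟩)).resolve_right hndvd
    have hcof : A 1 * qy + A 2 * qz = -h * q := mul_left_cancel₀ hx0 (by
      rw [hh] at hA; linear_combination hA)
    obtain ⟨v, v1, v2⟩ := exists_eq_euler_add_hamiltonian hrel hE hcof
    obtain ⟨w, hw⟩ := (isUnit_natCast (n := B.card) (by omega)).exists_left_inv
    refine ⟨![w * h, w * v], funext fun j => ?_⟩
    fin_cases j <;> simp [Fin.sum_univ_two]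
    · linear_combination hh - h * coordForm b 0 * hw
    · linear_combination w * v1 - A 1 * hw
    · linear_combination w * v2 - A 2 * hw
  · intro c hc0
    simp [key c hc0]
  · rw [Fintype.linearIndependent_iff]
    intro c hc0
    rw [sum_smul_fromCoords_eq_zero_iff] at hc0
    simp [key c hc0]

/-! ### Two pencils -/

open scoped Classical in
/-- Two pencils of at least two lines, with centres `b 1` and `b 0`, the line joining the centres
not being in the arrangement. In the coordinates `x, y, z` of `b` let `p(x, z)` and `q(y, z)` be the
forms of the pencils, `p = a x + z P` and `q = c y + z Q`, where `a` and `c` are multiples of powers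
of `x` and `y`. The first two generators are `(n₁ + n₂) p ∂x - p_x E` and `(n₁ + n₂) q ∂y - q_y E`,
where `E` is the Euler field; the third is their combination with coefficients `c` and `a`, divided
by `z`. -/
lemma isPlusOneGenerated_of_pencils {b : Module.Basis (Fin 3) ℂ (Fin 3 → ℂ)}
    {B₁ B₂ : Finset Line} (h₁ : ∀ L ∈ B₁, L.rep ⬝ᵥ b 1 = 0) (h₁' : ∀ L ∈ B₁, L.rep ⬝ᵥ b 0 ≠ 0)
    (h₂ : ∀ L ∈ B₂, L.rep ⬝ᵥ b 0 = 0) (h₂' : ∀ L ∈ B₂, L.rep ⬝ᵥ b 1 ≠ 0)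
    (hc₁ : 2 ≤ B₁.card) (hc : B₁.card ≤ B₂.card) :
    IsPlusOneGenerated (arrangementPoly (B₁ ∪ B₂))
      ![B₁.card, B₂.card, B₁.card + B₂.card - 2] := by
  have hne₁ : B₁.Nonempty := Finset.card_pos.mp (by omega)
  have hne₂ : B₂.Nonempty := Finset.card_pos.mp (by omega)
  have hdisj : Disjoint B₁ B₂ := Finset.disjoint_left.mpr fun L hL hL' => h₁' L hL (h₂ L hL')
  have hform₁ : ∀ M ∈ B₁, lineForm M =
      C (M.rep ⬝ᵥ b 0) * coordForm b 0 + C (M.rep ⬝ᵥ b 2) * coordForm b 2 := fun M hM => by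
    rw [lineForm_eq_linForm, linForm_eq_sum_coordForm b, Fin.sum_univ_three, h₁ M hM]
    simp
  have hform₂ : ∀ M ∈ B₂, lineForm M =
      C (M.rep ⬝ᵥ b 1) * coordForm b 1 + C (M.rep ⬝ᵥ b 2) * coordForm b 2 := fun M hM => by
    rw [lineForm_eq_linForm, linForm_eq_sum_coordForm b, Fin.sum_univ_three, h₂ M hM]
    simp
  have hE₁ := euler_pencil (by decide) hform₁
  have hE₂ := euler_pencil (by decide) hform₂
  have hrel₁ := isRelPrime_dirDeriv_pencil (by decide) hne₁ hform₁
  have hrel₂ := isRelPrime_dirDeriv_pencil (by decide) hne₂ hform₂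
  have hrel := isRelPrime_arrangementPoly hdisj
  have hp0 : dirDeriv (b 1) (arrangementPoly B₁) = 0 := by
    simpa using derivation_arrangementPoly (dirDeriv (b 1)) 0 (B := B₁) fun M hM => by
      rw [lineForm_eq_linForm, dirDeriv_linForm, h₁ M hM]; simp
  have hq0 : dirDeriv (b 0) (arrangementPoly B₂) = 0 := by
    simpa using derivation_arrangementPoly (dirDeriv (b 0)) 0 (B := B₂) fun M hM => by
      rw [lineForm_eq_linForm, dirDeriv_linForm, h₂ M hM]; simp
  obtain ⟨P, hP, eP⟩ := exists_pencil_eq_pow_add hne₁ hform₁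
  obtain ⟨Q, hQ, eQ⟩ := exists_pencil_eq_pow_add hne₂ hform₂
  have eP' := dirDeriv_of_pencil_eq_pow_add (by decide) eP
  have eQ' := dirDeriv_of_pencil_eq_pow_add (by decide) eQ
  have hα : ∏ L ∈ B₁, L.rep ⬝ᵥ b 0 ≠ 0 := Finset.prod_ne_zero_iff.mpr h₁'
  have hβ : ∏ L ∈ B₂, L.rep ⬝ᵥ b 1 ≠ 0 := Finset.prod_ne_zero_iff.mpr h₂'
  have hD : ∀ A : Fin 3 → S, ∑ l, A l * dirDeriv (b l) (arrangementPoly (B₁ ∪ B₂)) =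
      A 0 * (dirDeriv (b 0) (arrangementPoly B₁) * arrangementPoly B₂) +
      A 1 * (arrangementPoly B₁ * dirDeriv (b 1) (arrangementPoly B₂)) +
      A 2 * (dirDeriv (b 2) (arrangementPoly B₁) * arrangementPoly B₂ +
        arrangementPoly B₁ * dirDeriv (b 2) (arrangementPoly B₂)) := by
    intro A
    rw [arrangementPoly_union hdisj, Fin.sum_univ_three]
    simp only [Derivation.leibniz, hp0, hq0, smul_eq_mul]
    ring
  have hP' := dirDeriv_isHomogeneous (b 0) hP
  have hQ' := dirDeriv_isHomogeneous (b 1) hQ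
  have hp := arrangementPoly_isHomogeneous B₁
  have hq := arrangementPoly_isHomogeneous B₂
  have hpx := dirDeriv_isHomogeneous (b 0) hp
  have hqy := dirDeriv_isHomogeneous (b 1) hq
  have hp_ne := arrangementPoly_ne_zero B₁
  have hq_ne := arrangementPoly_ne_zero B₂
  have hx := coordForm_isHomogeneous b
  have hz := coordForm_prime b 2
  generalize ∏ L ∈ B₁, L.rep ⬝ᵥ b 0 = α at *
  generalize ∏ L ∈ B₂, L.rep ⬝ᵥ b 1 = β at *
  have hcop := @exists_coeffs_of_coordForm_dvd b α β hα hβ (B₁.card - 1) (B₂.card - 1)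
  have hmono : (C β * coordForm b 1 ^ (B₂.card - 1)).IsHomogeneous (B₂.card - 1) := by
    simpa using ((hx 1).pow (B₂.card - 1)).C_mul β
  have hmono' : (C α * coordForm b 0 ^ (B₁.card - 1)).IsHomogeneous (B₁.card - 1) := by
    simpa using ((hx 0).pow (B₁.card - 1)).C_mul α
  have hndvd : ¬ coordForm b 2 ∣ C β * coordForm b 1 ^ (B₂.card - 1) := by
    intro h
    rcases hz.dvd_or_dvd h with h | h
    · exact hz.not_isUnit (isUnit_of_dvd_unit h ((isUnit_iff_ne_zero.mpr hβ).map C))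
    · exact not_coordForm_dvd b (by decide) (hz.dvd_of_dvd_pow h)
  have ePow : C α * coordForm b 0 ^ B₁.card =
      C α * coordForm b 0 ^ (B₁.card - 1) * coordForm b 0 := by
    rw [mul_assoc, ← pow_succ, Nat.sub_add_cancel (by omega)]
  have ePow' : C β * coordForm b 1 ^ B₂.card =
      C β * coordForm b 1 ^ (B₂.card - 1) * coordForm b 1 := by
    rw [mul_assoc, ← pow_succ, Nat.sub_add_cancel (by omega)]
  rw [ePow] at eP
  rw [ePow'] at eQ
  -- From here on only the identities collected above are used, so the polynomials become variables.
  generalize arrangementPoly (B₁ ∪ B₂) = f at *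
  generalize arrangementPoly B₁ = p at *
  generalize arrangementPoly B₂ = q at *
  generalize dirDeriv (b 0) p = px at *
  generalize dirDeriv (b 2) p = pz at *
  generalize dirDeriv (b 1) q = qy at *
  generalize dirDeriv (b 2) q = qz at *
  generalize dirDeriv (b 0) P = P' at *
  generalize dirDeriv (b 1) Q = Q' at *
  generalize C α * coordForm b 0 ^ (B₁.card - 1) = a at *
  generalize C β * coordForm b 1 ^ (B₂.card - 1) = c at *
  have hn₁ : (B₁.card : S) ≠ 0 := Nat.cast_ne_zero.mpr (by omega)
  have hn₂ : (B₂.card : S) ≠ 0 := Nat.cast_ne_zero.mpr (by omega)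
  have hN := isUnit_natCast (n := B₁.card + B₂.card) (by omega)
  have hhom : ∀ g : S, ∀ n, g.IsHomogeneous n →
      (((B₁.card : S) + B₂.card) * g).IsHomogeneous n := fun g n hg => by
    rw [← Nat.cast_add, ← map_natCast C]; exact hg.C_mul _
  push_cast at hN
  generalize hn₁' : (B₁.card : S) = n₁ at *
  generalize hn₂' : (B₂.card : S) = n₂ at *
  have hz0 := hz.ne_zero
  generalize hx0 : coordForm b 0 = x at *
  generalize hx1 : coordForm b 1 = y at *
  generalize hx2 : coordForm b 2 = z at *
  have hxx : x.IsHomogeneous 1 := hx0 ▸ hx 0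
  have hyy : y.IsHomogeneous 1 := hx1 ▸ hx 1
  have hzz : z.IsHomogeneous 1 := hx2 ▸ hx 2
  set G : Fin 3 → Fin 3 → S := ![![(n₁ + n₂) * p - x * px, -(y * px), -(z * px)],
    ![-(x * qy), (n₁ + n₂) * q - y * qy, -(z * qy)],
    ![c * ((n₁ + n₂) * P - x * P') - a * (x * Q'), a * ((n₁ + n₂) * Q - y * Q') - c * (y * P'),
      -(c * px + a * qy)]] with hG
  have hG2 : z • G 2 = c • G 0 + a • G 1 := by
    ext1 j
    fin_cases j <;> simp [hG]
    · linear_combination -(c * (n₁ + n₂)) * eP + c * x * eP' + a * x * eQ'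
    · linear_combination -(a * (n₁ + n₂)) * eQ + a * y * eQ' + c * y * eP'
    · ring
  have hli : ∀ s t : S, s • G 0 + t • G 1 = 0 → s = 0 ∧ t = 0 := by
    intro s t e
    have e0 := congrFun e 0
    have e1 := congrFun e 1
    have e2 := congrFun e 2
    simp [hG] at e0 e1 e2
    have e2' : s * px + t * qy = 0 := mul_left_cancel₀ hz0 (by linear_combination -e2)
    refine ⟨mul_right_cancel₀ (mul_ne_zero hN.ne_zero hp_ne) ?_,
      mul_right_cancel₀ (mul_ne_zero hN.ne_zero hq_ne) ?_⟩
    · linear_combination e0 + x * e2'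
    · linear_combination e1 + y * e2'
  have hrelG : ∀ g : Fin 3 → S, ∑ i, g i • G i = 0 ↔ ∃ t : S, g = t • ![-c, -a, z] := by
    intro g
    constructor
    · intro e
      -- Multiplied by `z`, the relation is one between the first two generators.
      have e' : (z * g 0 + g 2 * c) • G 0 + (z * g 1 + g 2 * a) • G 1 = 0 := by
        rw [Fin.sum_univ_three] at e
        calc _ = z • (g 0 • G 0 + g 1 • G 1) + g 2 • (c • G 0 + a • G 1) := by module
          _ = z • (g 0 • G 0 + g 1 • G 1 + g 2 • G 2) := by rw [← hG2]; module
          _ = 0 := by rw [e, smul_zero]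
      obtain ⟨e1, e2⟩ := hli _ _ e'
      obtain ⟨t, ht⟩ := (hz.dvd_or_dvd (show z ∣ g 2 * c from
        ⟨-g 0, by linear_combination e1⟩)).resolve_right hndvd
      refine ⟨t, funext fun j => ?_⟩
      fin_cases j <;> simp
      · exact mul_left_cancel₀ hz0 (by linear_combination e1 - c * ht)
      · exact mul_left_cancel₀ hz0 (by linear_combination e2 - a * ht)
      · rw [ht, mul_comm]
    · rintro ⟨t, rfl⟩
      have : t • (z • G 2 - (c • G 0 + a • G 1)) = 0 := by rw [hG2, sub_self, smul_zero]
      rw [← this, Fin.sum_univ_three]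
      simp
      module
  have hρ : ∀ i, (![-c, -a, z] i).IsHomogeneous
      (![B₁.card, B₂.card, B₁.card + B₂.card - 2] 2 + 1 -
        ![B₁.card, B₂.card, B₁.card + B₂.card - 2] i) := by
    intro i
    fin_cases i <;> simp
    · convert! hmono.neg using 1; omega
    · convert! hmono'.neg using 1; omega
    · convert! hzz using 1
  refine ⟨_, isMinimalGenerators_fromCoords b (G := G) ?_ ?_ ?_ ?_ ?_, ![-c, -a, z], ?_, hρ, ?_⟩
  · intro i j hij
    fin_cases i <;> fin_cases j <;> simp at hij ⊢ <;> omega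
  · have ofDeg : ∀ {g : S} {n m : ℕ}, g.IsHomogeneous n → n = m → g.IsHomogeneous m :=
      fun h e => e ▸ h
    intro i j
    fin_cases i <;> fin_cases j
    · exact (hhom _ _ hp).sub (ofDeg (hxx.mul hpx) (by omega))
    · exact ofDeg (hyy.mul hpx).neg (by simp; omega)
    · exact ofDeg (hzz.mul hpx).neg (by simp; omega)
    · exact ofDeg (hxx.mul hqy).neg (by simp; omega)
    · exact (hhom _ _ hq).sub (ofDeg (hyy.mul hqy) (by omega))
    · exact ofDeg (hzz.mul hqy).neg (by simp; omega)
    · exact (ofDeg (hmono.mul ((hhom _ _ hP).sub (ofDeg (hxx.mul hP') (by omega))))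
        (by simp; omega)).sub (ofDeg (hmono'.mul (hxx.mul hQ')) (by simp; omega))
    · exact (ofDeg (hmono'.mul ((hhom _ _ hQ).sub (ofDeg (hyy.mul hQ') (by omega))))
        (by simp; omega)).sub (ofDeg (hmono.mul (hyy.mul hP')) (by simp; omega))
    · exact ((ofDeg (hmono.mul hpx) (by simp; omega)).add
        (ofDeg (hmono'.mul hqy) (by simp; omega))).neg
  · have h01 : ∀ i : Fin 3, i ≠ 2 → ∑ l, G i l * dirDeriv (b l) f = 0 := by
      intro i hi
      rw [hD]
      fin_cases i
      · simp [hG]; linear_combination -(px * q) * hE₁ - (px * p) * hE₂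
      · simp [hG]; linear_combination -(qy * q) * hE₁ - (qy * p) * hE₂
      · exact absurd rfl hi
    intro i
    by_cases hi : i = 2
    · subst hi
      refine mul_left_cancel₀ hz0 ?_
      have e : ∀ l, z * G 2 l = c * G 0 l + a * G 1 l := fun l => by simpa using congrFun hG2 l
      simp only [Finset.mul_sum, ← mul_assoc, e]
      simp only [add_mul, mul_assoc, Finset.sum_add_distrib, ← Finset.mul_sum,
        h01 0 (by decide), h01 1 (by decide), mul_zero, add_zero]
    · exact h01 i hi
  · intro A hA
    rw [hD] at hA
    obtain ⟨u, v, hd, e0, e1, e2⟩ := exists_coeffs_of_syzygy hn₁ hn₂ hp_ne hrel hrel₁ hrel₂ hE₁ hE₂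
      hA
    have hd' : z ∣ u * a - v * c := by
      have h1 : z ∣ n₁ * n₂ * (u * a - v * c) := by
        obtain ⟨g, hg⟩ := hd
        refine ⟨g - n₂ * u * P' + n₁ * v * Q', ?_⟩
        linear_combination hg - n₂ * u * eP' + n₁ * v * eQ'
      have hu : IsUnit (n₁ * n₂) := by
        rw [← hn₁', ← hn₂']
        exact (isUnit_natCast (by omega)).mul (isUnit_natCast (by omega))
      exact hu.dvd_mul_left.mp h1
    -- Hence `(n₁ + n₂) z A`, a combination of the first two generators with coefficients `u` and
    -- `v`, is `z` times a combination of all three.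
    obtain ⟨w, s, t, rfl, rfl⟩ := hcop hd'
    obtain ⟨m, hm⟩ := hN.exists_left_inv
    refine ⟨![m * s, m * t, m * w], ?_⟩
    have hzA : ((n₁ + n₂) * z) • A =
        (w * c + z * s) • G 0 + (w * a + z * t) • G 1 := by
      ext1 j
      fin_cases j <;> simp [hG]
      · linear_combination e0
      · linear_combination e1
      · linear_combination e2
    have hzA' : z • A = z • ∑ i, ![m * s, m * t, m * w] i • G i := by
      calc z • A = (m * (n₁ + n₂)) • z • A := by rw [hm, one_smul]
        _ = m • ((n₁ + n₂) * z) • A := by module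
        _ = m • (w • (c • G 0 + a • G 1) + z • (s • G 0 + t • G 1)) := by rw [hzA]; module
        _ = z • ∑ i, ![m * s, m * t, m * w] i • G i := by
          rw [← hG2, Fin.sum_univ_three]
          simp
          module
    exact smul_right_injective _ hz0 hzA'
  · intro g hg i
    obtain ⟨t, rfl⟩ := (hrelG g).mp hg
    -- As `2 ≤ n₁ ≤ n₂`, the entries of the relation have positive degree, even when two of the
    -- exponents agree.
    have : constantCoeff (![-c, -a, z] i) = 0 :=
      constantCoeff_eq_zero_of_isHomogeneous (hρ i) (by fin_cases i <;> simp <;> omega)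
    simp [this]
  · intro h
    exact hz0 (congrFun h 2)
  · intro g
    rw [sum_smul_fromCoords_eq_zero_iff]
    exact hrelG g

end PlaneCurve

end

open scoped Classical in
theorem proposition1p18 (n₁ n₂ : ℕ) (h₁ : 1 ≤ n₁) (h₁₂ : n₁ ≤ n₂) (h₂ : 2 < n₁ + n₂)
    (a₁ a₂ : PlaneCurve.Plane) (B₁ B₂ : Finset PlaneCurve.Line)
    (hB₁ : B₁.card = n₁) (hB₂ : B₂.card = n₂)
    (ha₁ : ∀ L ∈ B₁, PlaneCurve.OnLine a₁ L) (ha₂ : ∀ L ∈ B₂, PlaneCurve.OnLine a₂ L)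
    (ha₂B₁ : ∀ L ∈ B₁, ¬ PlaneCurve.OnLine a₂ L) :
    (n₁ = 1 →
      PlaneCurve.IsFreeCurve (PlaneCurve.arrangementPoly (B₁ ∪ B₂)) ∧
      PlaneCurve.HasType (PlaneCurve.arrangementPoly (B₁ ∪ B₂)) 0 ∧
      PlaneCurve.HasExponents (PlaneCurve.arrangementPoly (B₁ ∪ B₂)) ![1, n₁ + n₂ - 2]) ∧
    (2 ≤ n₁ → (∀ L ∈ B₂, ¬ PlaneCurve.OnLine a₁ L) →
      PlaneCurve.IsPlusOneGenerated (PlaneCurve.arrangementPoly (B₁ ∪ B₂))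
        ![n₁, n₂, n₁ + n₂ - 2] ∧
      PlaneCurve.HasType (PlaneCurve.arrangementPoly (B₁ ∪ B₂)) 1 ∧
      PlaneCurve.HasExponents (PlaneCurve.arrangementPoly (B₁ ∪ B₂))
        ![n₁, n₂, n₁ + n₂ - 2]) := by
  have hdisj : Disjoint B₁ B₂ :=
    Finset.disjoint_left.mpr fun L hL hL' => ha₂B₁ L hL (ha₂ L hL')
  have hdeg : (PlaneCurve.arrangementPoly (B₁ ∪ B₂)).totalDegree = n₁ + n₂ := by
    rw [PlaneCurve.totalDegree_arrangementPoly, Finset.card_union_of_disjoint hdisj, hB₁, hB₂]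
  simp only [PlaneCurve.onLine_iff] at ha₁ ha₂ ha₂B₁ ⊢
  obtain ⟨L₀, hL₀⟩ : B₁.Nonempty := Finset.card_pos.mp (by omega)
  -- The condition that `b 2` lies on `L₀` matters only if `L₀` is the single line of `B₁`.
  obtain ⟨b, hb0, hb1, hb2⟩ :=
    PlaneCurve.exists_basis (ha₂B₁ L₀ hL₀) (ha₁ L₀ hL₀) a₁.rep_nonzero
  simp only [← hb0] at ha₂ ha₂B₁
  simp only [← hb1] at ha₁ ⊢
  subst hB₁ hB₂
  constructor
  · intro hc
    obtain ⟨L, rfl⟩ := Finset.card_eq_one.mp hc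
    obtain rfl : L₀ = L := Finset.mem_singleton.mp hL₀
    obtain ⟨r, hr, hli⟩ := PlaneCurve.exists_basis_of_line_union_pencil (ha₂B₁ L₀ hL₀)
      (ha₁ L₀ hL₀) hb2 ha₂ (by omega)
    have e : B₂.card - 1 = ({L₀} : Finset PlaneCurve.Line).card + B₂.card - 2 := by omega
    rw [e] at hr
    refine ⟨?_, ⟨0, _, ⟨r, hr⟩, ?_⟩, r, hr⟩
    · rw [PlaneCurve.IsFreeCurve, ← hr.span_eq]
      exact Module.Free.of_basis (Module.Basis.span hli)
    · rw [hdeg]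
      simp
      omega
  · intro hc h₂'
    have h := PlaneCurve.isPlusOneGenerated_of_pencils ha₁ ha₂B₁ ha₂ h₂' hc h₁₂
    obtain ⟨r, hr, -⟩ := id h
    refine ⟨h, ⟨1, _, ⟨r, hr⟩, ?_⟩, r, hr⟩
    rw [hdeg]
    simp
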